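/- An instance of Bernoulli stochastic probing on the ground set $U=[n]$ consists of probabilities $p_i\in[0,1]$ ($i\in U$), a nonempty prefix-closed family $\mathcal F$ of sequences of distinct elements of $U$, and an objective $f:2^U\to\mathbb R_{\ge 0}$. Each element $i$ is active with probability $p_i$, independently of the others; $\mathrm{Ac}(P)$ denotes the set of active elements of $P\subseteq U$. An adaptive strategy is a binary decision tree $\mathcal T$ in which each internal node probes an element of $U$ and branches according to whether this element is active, and in which the sequence of elements on every root-to-leaf path belongs to $\mathcal F$; its reward is $\mathsf{Adap}(\mathcal T,f)=\mathbb E_{\ell}[f(A_\ell)]$, where $\ell$ is the random leaf that is reached and $A_\ell$ is the set of elements on the path to $\ell$ that are active. A non-adaptive strategy is a sequence $P\in\mathcal F$ fixed in advance; its reward is $\mathbb E[f(\mathrm{Ac}(P))]$. The adaptivity gap of the instance is the ratio of the maximal reward of an adaptive strategy to the maximal reward of a non-adaptive strategy (instances on which both are $0$ being disregarded). The function $f$ is binary-XOS if there are finitely many (at least one) weight vectors $w^{(1)},\dots,w^{(W)}\in\{0,1\}^U$ with $f(S)=\max_{i\in[W]}\sum_{j\in S}w^{(i)}_j$ for all $S\subseteq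 U$. Let $\Lambda_{\mathrm{bxos}}(n)$ be the supremum of the adaptivity gap over all instances on $[n]$ whose objective is binary-XOS. **Theorem.** $\Lambda_{\mathrm{bxos}}(n)=\Theta\!\left(\frac{\log n}{\log\log n}\right)$ as $n\to\infty$; that is, there are absolute constants $c,C>0$ such that for all sufficiently large $n$ $$c\,\frac{\log n}{\log\log n}\;\le\;\Lambda_{\mathrm{bxos}}(n)\;\le\;C\,\frac{\log n}{\log\log n},$$ where $\log$ is the logarithm to base $2$. -/

import Mathlib

open Filter
open scoped ENNReal

namespace StochasticProbing

/-- A set function on subsets of `U = [n]` is binary-XOS if it is the pointwise maximum of finitely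
many (at least one, since the maximum is attained) additive functions with `0/1` weights. -/
def IsBinaryXOS {n : ℕ} (f : Finset (Fin n) → ℝ) : Prop :=
  ∃ (W : ℕ) (w : Fin W → Fin n → ℝ),
    (∀ i j, w i j = 0 ∨ w i j = 1) ∧
    ∀ S : Finset (Fin n), IsGreatest (Set.range fun i => ∑ j ∈ S, w i j) (f S)

/-- The data of Bernoulli stochastic probing on the ground set `U = [n]`, apart from the objective:
the activation probabilities of the (independent) elements, and a nonempty prefix-closed family of
sequences of distinct elements along which probing is allowed. -/
structure Instance (n : ℕ) where
  p : Fin n → ℝ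
  p_nonneg : ∀ i, 0 ≤ p i
  p_le_one : ∀ i, p i ≤ 1
  feasible : Set (List (Fin n))
  nodup : ∀ σ ∈ feasible, σ.Nodup
  nil_mem : [] ∈ feasible
  prefix_closed : ∀ σ ∈ feasible, ∀ τ : List (Fin n), τ <+: σ → τ ∈ feasible

/-- Adaptive strategy trees: a leaf stops; an internal node probes the element `i` and continues
with the tree `yes` if `i` is active and with the tree `no` otherwise. -/
inductive StrategyTree (n : ℕ) where
  | leaf : StrategyTree n
  | node (i : Fin n) (yes no : StrategyTree n) : StrategyTree n

/-- What is recorded about a leaf of a strategy tree: the probability of reaching it, the sequence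
of elements on the path from the root to it, and the set of those elements on the path that are
active (whose `yes` arc is taken). -/
structure LeafData (n : ℕ) where
  prob : ℝ
  path : List (Fin n)
  active : Finset (Fin n)

/-- The leaves of a strategy tree, for activation probabilities `p`. -/
def StrategyTree.leaves {n : ℕ} (p : Fin n → ℝ) : StrategyTree n → List (LeafData n)
  | .leaf => [⟨1, [], ∅⟩]
  | .node i yes no =>
      (yes.leaves p).map (fun l => ⟨p i * l.prob, i :: l.path, insert i l.active⟩) ++
      (no.leaves p).map (fun l => ⟨(1 - p i) * l.prob, i :: l.path, l.active⟩)

namespace Instance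

variable {n : ℕ}

/-- A strategy tree is an adaptive strategy for the instance if every root-to-leaf path is an
allowed sequence (in particular, no element is repeated on such a path). -/
def IsAdaptiveStrategy (I : Instance n) (T : StrategyTree n) : Prop :=
  ∀ l ∈ T.leaves I.p, l.path ∈ I.feasible

/-- Expected reward of an adaptive strategy: the expectation, over the random leaf that is reached,
of the objective at the set of active elements on the path. -/
def adap (I : Instance n) (f : Finset (Fin n) → ℝ) (T : StrategyTree n) : ℝ :=
  ((T.leaves I.p).map fun l => l.prob * f l.active).sum

/-- Expected reward `𝔼[f(Ac(P))]` of probing all elements of a fixed set `P`, each of them being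
active independently of the others; the sum runs over the possible sets `S = Ac(P)`. -/
def nonadap (I : Instance n) (f : Finset (Fin n) → ℝ) (P : Finset (Fin n)) : ℝ :=
  ∑ S ∈ P.powerset, (∏ i ∈ S, I.p i) * (∏ i ∈ P \ S, (1 - I.p i)) * f S

/-- Optimal expected reward of an adaptive strategy. -/
noncomputable def optAdap (I : Instance n) (f : Finset (Fin n) → ℝ) : ℝ≥0∞ :=
  ⨆ (T : StrategyTree n) (_ : I.IsAdaptiveStrategy T), ENNReal.ofReal (I.adap f T)

/-- Optimal expected reward of a non-adaptive strategy, which commits in advance to an allowed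
sequence. -/
noncomputable def optNonadap (I : Instance n) (f : Finset (Fin n) → ℝ) : ℝ≥0∞ :=
  ⨆ (σ : List (Fin n)) (_ : σ ∈ I.feasible), ENNReal.ofReal (I.nonadap f σ.toFinset)

/-- The adaptivity gap of one instance and one objective. In `ℝ≥0∞`, a positive number divided by
`0` is `∞`, and `0 / 0 = 0` (an instance on which no strategy earns anything). -/
noncomputable def adaptivityGap (I : Instance n) (f : Finset (Fin n) → ℝ) : ℝ≥0∞ :=
  I.optAdap f / I.optNonadap f

end Instance

/-- The adaptivity gap for Bernoulli stochastic probing with binary-XOS objectives on a ground set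
of `n` elements: the supremum over all instances and all binary-XOS objectives. -/
noncomputable def binaryXOSGap (n : ℕ) : ℝ≥0∞ :=
  ⨆ (I : Instance n) (f : Finset (Fin n) → ℝ) (_ : IsBinaryXOS f), I.adaptivityGap f

end StochasticProbing

namespace StochasticProbing

open Finset

variable {n : ℕ}

/-! Upper bound. Let α bound the non-adaptive reward of every root-to-leaf path, and label each leaf
by a weight set attaining the objective there. Along the tree one builds a random set S contained in
the label of a random leaf and stochastically dominated by a fresh sample of a random path
(`exists_isShadowLaw`). Containment gives |S| ≤ f(S), and domination gives E f(S) ≤ α, so E|S| ≤ α.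
The construction loses little: l times the adaptive reward is at most H(S) + (e^l - 1) E|S|, for
every l ≥ 0. Since H(S) ≤ log n · E|S| + 2, the choice l = log log n bounds the adaptive reward by
O((α + 1) log n / log log n). This suffices for α ≥ 1/2 (`mul_expect_le`). For α ≤ 1/2 the adaptive
reward is at most 2α, because a path of small reward carries little total probability on elements of
positive weight (`expect_le_two_mul`).

Lower bound. Elements are the nodes of a k-ary tree of depth k, each active with probability 1/k,
and the objective is the largest number of chosen nodes on a downward path. Probing children until
one is active and descending there earns at least k/2 (`le_expect_walk`). A path fixed in advance
consists of a spine and siblings of it; a downward path leaves the spine at most once, so the reward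
is at most 1 + k · (1/k) = 2 (`exists_spine`). About (k+1)^k elements suffice, which allows k of
order log n / log log n. -/

/-! ### Expectations over random leaves and independent samples -/

/-- Expectation over the random leaf of a strategy tree. -/
def StrategyTree.expect (p : Fin n → ℝ) (T : StrategyTree n)
    (g : List (Fin n) → Finset (Fin n) → ℝ) : ℝ :=
  ((T.leaves p).map fun l => l.prob * g l.path l.active).sum

/-- Expectation of `g` over the random set of active elements of `P`. -/
def probeExpect (p : Fin n → ℝ) (g : Finset (Fin n) → ℝ) (P : Finset (Fin n)) : ℝ :=
  ∑ S ∈ P.powerset, (∏ i ∈ S, p i) * (∏ i ∈ P \ S, (1 - p i)) * g S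

namespace StrategyTree

theorem expect_leaf (p : Fin n → ℝ) (g : List (Fin n) → Finset (Fin n) → ℝ) :
    expect p .leaf g = g [] ∅ := by
  simp [expect, leaves]

theorem expect_node (p : Fin n → ℝ) (i : Fin n) (Y N : StrategyTree n)
    (g : List (Fin n) → Finset (Fin n) → ℝ) :
    expect p (.node i Y N) g = p i * expect p Y (fun P A => g (i :: P) (insert i A)) +
      (1 - p i) * expect p N (fun P A => g (i :: P) A) := by
  simp only [expect, leaves, List.map_append, List.map_map, List.sum_append, Function.comp_def,
    mul_assoc, List.sum_map_mul_left]

theorem prob_nonneg {p : Fin n → ℝ} (h0 : ∀ i, 0 ≤ p i) (h1 : ∀ i, p i ≤ 1)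
    (T : StrategyTree n) : ∀ l ∈ T.leaves p, 0 ≤ l.prob := by
  induction T with
  | leaf => simp [leaves]
  | node i Y N hY hN =>
    intro l hl
    simp only [leaves, List.mem_append, List.mem_map] at hl
    rcases hl with ⟨l, hl, rfl⟩ | ⟨l, hl, rfl⟩
    · exact mul_nonneg (h0 i) (hY l hl)
    · exact mul_nonneg (sub_nonneg.2 (h1 i)) (hN l hl)

theorem active_subset_path {p : Fin n → ℝ} (T : StrategyTree n) :
    ∀ l ∈ T.leaves p, l.active ⊆ l.path.toFinset := by
  induction T with
  | leaf => simp [leaves]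
  | node i Y N hY hN =>
    intro l hl
    simp only [leaves, List.mem_append, List.mem_map] at hl
    rcases hl with ⟨l, hl, rfl⟩ | ⟨l, hl, rfl⟩
    · simpa using insert_subset_insert i (hY l hl)
    · simpa using (hN l hl).trans (subset_insert _ _)

theorem expect_mono {p : Fin n → ℝ} (h0 : ∀ i, 0 ≤ p i) (h1 : ∀ i, p i ≤ 1)
    (T : StrategyTree n) {g h : List (Fin n) → Finset (Fin n) → ℝ}
    (H : ∀ l ∈ T.leaves p, g l.path l.active ≤ h l.path l.active) :
    T.expect p g ≤ T.expect p h :=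
  List.sum_le_sum fun l hl => mul_le_mul_of_nonneg_left (H l hl) (prob_nonneg h0 h1 T l hl)

theorem expect_congr {p : Fin n → ℝ} (T : StrategyTree n)
    {g h : List (Fin n) → Finset (Fin n) → ℝ}
    (H : ∀ l ∈ T.leaves p, g l.path l.active = h l.path l.active) :
    T.expect p g = T.expect p h := by
  unfold expect
  congr 1
  exact List.map_congr_left fun l hl => by rw [H l hl]

theorem expect_add (p : Fin n → ℝ) (T : StrategyTree n)
    (g h : List (Fin n) → Finset (Fin n) → ℝ) :
    T.expect p (fun P A => g P A + h P A) = T.expect p g + T.expect p h := by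
  simp only [expect, mul_add, List.sum_map_add]

theorem expect_const (p : Fin n → ℝ) (T : StrategyTree n) (c : ℝ) :
    T.expect p (fun _ _ => c) = c := by
  induction T with
  | leaf => simp [expect_leaf]
  | node i Y N hY hN => rw [expect_node, hY, hN]; ring

theorem expect_sum (p : Fin n → ℝ) (T : StrategyTree n) {ι : Type*} (s : Finset ι)
    (g : ι → List (Fin n) → Finset (Fin n) → ℝ) :
    T.expect p (fun P A => ∑ j ∈ s, g j P A) = ∑ j ∈ s, T.expect p (g j) := by
  classical
  induction s using Finset.induction_on with
  | empty => simpa using expect_const p T 0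
  | insert a s ha ih => simp only [sum_insert ha, expect_add, ih]

end StrategyTree

theorem probeExpect_insert (p : Fin n → ℝ) (g : Finset (Fin n) → ℝ) {i : Fin n}
    {P : Finset (Fin n)} (hi : i ∉ P) :
    probeExpect p g (insert i P) =
      probeExpect p (fun S => p i * g (insert i S) + (1 - p i) * g S) P := by
  unfold probeExpect
  rw [sum_powerset_insert hi, ← sum_add_distrib]
  refine sum_congr rfl fun S hS => ?_
  have hiS : i ∉ S := fun h => hi (mem_powerset.1 hS h)
  rw [insert_sdiff_of_notMem _ hiS, prod_insert (fun h => hi (mem_sdiff.1 h).1),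
    prod_insert hiS, insert_sdiff_insert, sdiff_insert_of_notMem hi]
  ring

/-! ### Entropy inequalities -/

/-- One probe of the shadow construction at a fixed S: `a` and `b` are the masses from the two
branches, `m` the part of `a` whose label contains the probed element. If `m` is at most the
mixture, concavity and l ≤ e^l - 1 suffice. Otherwise `a` exceeds the mixture, and the entropy lost
by conditioning on the outcome pays for the excess. -/
theorem entropy_step {p a b m l : ℝ} (hp0 : 0 ≤ p) (hp1 : p ≤ 1) (hb : 0 ≤ b)
    (hm0 : 0 ≤ m) (hma : m ≤ a) (hl : 0 ≤ l) :
    l * (p * m) + p * Real.negMulLog a + (1 - p) * Real.negMulLog b ≤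
      Real.negMulLog (p * a + (1 - p) * b) +
        (Real.exp l - 1) * (p * min m (p * a + (1 - p) * b)) := by
  have ha : 0 ≤ a := hm0.trans hma
  have hq : 0 ≤ 1 - p := sub_nonneg.2 hp1
  have hconc := Real.concaveOn_negMulLog.2 (Set.mem_Ici.2 ha) (Set.mem_Ici.2 hb) hp0 hq
    (by ring)
  simp only [smul_eq_mul] at hconc
  have hexp : l + 1 ≤ Real.exp l := Real.add_one_le_exp l
  set c := p * a + (1 - p) * b with hc
  have hc0 : 0 ≤ c := by positivity
  rcases le_or_gt m c with hmc | hmc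
  · rw [min_eq_left hmc]
    nlinarith [mul_nonneg (mul_nonneg hp0 hm0) (sub_nonneg.2 hexp)]
  rw [min_eq_right hmc.le]
  rcases hp0.eq_or_lt with rfl | hp
  · simp at hconc ⊢; linarith
  have hapos : 0 < a := by linarith
  have hcpos : 0 < c := by positivity
  have key : ∀ x : ℝ, 0 ≤ x → ∀ y : ℝ, 0 < y → x * Real.log y + x - y ≤ -Real.negMulLog x := by
    intro x hx y hy
    rcases hx.eq_or_lt with rfl | hx
    · simp; exact hy.le
    have := Real.log_le_sub_one_of_pos (div_pos hy hx)
    rw [Real.log_div hy.ne' hx.ne'] at this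
    have h2 := mul_le_mul_of_nonneg_left this hx.le
    have h3 : x * (y / x - 1) = y - x := by field_simp
    unfold Real.negMulLog
    nlinarith
  -- Tilting the reference mass by e^l makes the term l · a appear, at the price (e^l - 1) · p · c
  -- after averaging.
  have k1 := key a ha (c * Real.exp l) (by positivity)
  rw [Real.log_mul hcpos.ne' (Real.exp_pos l).ne', Real.log_exp] at k1
  have k2 := key b hb c hcpos
  have k1' := mul_le_mul_of_nonneg_left k1 hp0
  have k2' := mul_le_mul_of_nonneg_left k2 hq
  have e : Real.negMulLog c = -(p * a + (1 - p) * b) * Real.log c := by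
    rw [← hc]; rfl
  rw [e]
  have : l * (p * m) ≤ l * (p * a) := by gcongr
  nlinarith

/-- Monotonicity of log: splitting an atom cannot lower the entropy. Needed when part of the mass at
S moves to `insert i S`. -/
theorem negMulLog_add_le {a b : ℝ} (ha : 0 ≤ a) (hb : 0 ≤ b) :
    Real.negMulLog (a + b) ≤ Real.negMulLog a + Real.negMulLog b := by
  have key : ∀ x y : ℝ, 0 ≤ x → 0 ≤ y → x * Real.log x ≤ x * Real.log (x + y) := by
    intro x y hx hy
    rcases hx.eq_or_lt with rfl | hx
    · simp
    · exact mul_le_mul_of_nonneg_left (Real.log_le_log hx (by linarith)) hx.le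
  have h1 := key a b ha hb
  have h2 := key b a hb ha
  rw [add_comm b a] at h2
  unfold Real.negMulLog
  nlinarith

/-! ### Shadow laws -/

theorem sum_finset_eq (i : Fin n) (F : Finset (Fin n) → ℝ) :
    ∑ S, F S = ∑ S ∈ (univ.erase i).powerset, (F S + F (insert i S)) := by
  have h : (univ : Finset (Finset (Fin n))) = (insert i (univ.erase i)).powerset := by
    rw [insert_erase (mem_univ i)]; simp
  rw [h, sum_powerset_insert (notMem_erase i univ), sum_add_distrib]

theorem sum_finset_eq_of_zero (i : Fin n) (F : Finset (Fin n) → ℝ) (h : ∀ S, i ∈ S → F S = 0) :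
    ∑ S, F S = ∑ S ∈ (univ.erase i).powerset, F S := by
  rw [sum_finset_eq i]
  exact sum_congr rfl fun S _ => by rw [h _ (mem_insert_self i S), add_zero]

/-- A joint law `ω` of a set `S` of active elements and a weight set `C ⊇ S`, adapted to a strategy
tree whose leaves are labelled by the weight sets `W A`: the law of `C` is that of the label of the
random leaf, the law of `S` is dominated by that of a fresh sample of the elements of a random
root-to-leaf path, and the expected size of `A ∩ W A` is controlled by the entropy and
the expected size of `S`. -/
structure IsShadowLaw (p : Fin n → ℝ) (T : StrategyTree n) (W : Finset (Fin n) → Finset (Fin n))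
    (l : ℝ) (ω : Finset (Fin n) → Finset (Fin n) → ℝ) : Prop where
  nonneg : ∀ S C, 0 ≤ ω S C
  subset : ∀ S C, ω S C ≠ 0 → S ⊆ C
  mem_range : ∀ S C, ω S C ≠ 0 → ∃ A, W A = C
  subset_path : ∀ S C, ω S C ≠ 0 → ∃ x ∈ T.leaves p, S ⊆ x.path.toFinset
  marginal : ∀ C, ∑ S, ω S C = T.expect p (fun _ A => if W A = C then 1 else 0)
  dominated : ∀ g : Finset (Fin n) → ℝ, Monotone g →
    ∑ S, (∑ C, ω S C) * g S ≤ T.expect p (fun P _ => probeExpect p g P.toFinset)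
  entropy : l * T.expect p (fun _ A => ((A ∩ W A).card : ℝ)) ≤
    ∑ S, Real.negMulLog (∑ C, ω S C) + (Real.exp l - 1) * ∑ S, (∑ C, ω S C) * (S.card : ℝ)

/-- The law obtained at a node probing `i` from the laws `u` (active) and `v` (inactive) of the
subtrees: a fraction `β S` of the mass of `u` at `(S, C)` with `i ∈ C` is moved to
`(insert i S, C)`. -/
def nodeLaw (q : ℝ) (i : Fin n) (β : Finset (Fin n) → ℝ)
    (u v : Finset (Fin n) → Finset (Fin n) → ℝ) (S C : Finset (Fin n)) : ℝ :=
  if i ∈ S then (if i ∈ C then q * β (S.erase i) * u (S.erase i) C else 0)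
  else q * u S C + (1 - q) * v S C - (if i ∈ C then q * β S * u S C else 0)

/-- Induction on the tree. At a node probing `i` the subtree laws are mixed, and mass q · min(m, c)
at S, taken from active-branch labels containing `i`, receives the element `i`. The bound m keeps S
inside its label; the bound c keeps S dominated, since a fresh sample adds `i` to a fraction q of
the mixed mass c. -/
theorem exists_isShadowLaw {p : Fin n → ℝ} (h0 : ∀ i, 0 ≤ p i) (h1 : ∀ i, p i ≤ 1) {l : ℝ}
    (hl : 0 ≤ l) (T : StrategyTree n) (hT : ∀ x ∈ T.leaves p, x.path.Nodup)
    (W : Finset (Fin n) → Finset (Fin n)) : ∃ ω, IsShadowLaw p T W l ω := by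
  induction T generalizing W with
  | leaf =>
    refine ⟨fun S C => if S = ∅ ∧ C = W ∅ then 1 else 0, ?_, ?_, ?_, ?_, ?_, ?_, ?_⟩
    · intro S C; split_ifs <;> norm_num
    · intro S C h
      have : S = ∅ := by by_contra h'; simp [h'] at h
      simp [this]
    · intro S C h
      refine ⟨∅, ?_⟩
      by_contra h'
      exact h (if_neg fun h'' => h' h''.2.symm)
    · intro S C h
      have : S = ∅ := by by_contra h'; simp [h'] at h
      simp [this, StrategyTree.leaves]
    · intro C
      simp [StrategyTree.expect_leaf, ite_and, eq_comm]
    · intro g _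
      simp [StrategyTree.expect_leaf, ite_and, probeExpect]
    · simp [StrategyTree.expect_leaf, ite_and, apply_ite Real.negMulLog]
  | node i Y N hY hN =>
    have hYn : ∀ x ∈ Y.leaves p, i ∉ x.path ∧ x.path.Nodup := fun x hx => by
      simpa using hT ⟨p i * x.prob, i :: x.path, insert i x.active⟩
        (by simp only [StrategyTree.leaves, List.mem_append, List.mem_map]; exact .inl ⟨x, hx, rfl⟩)
    have hNn : ∀ x ∈ N.leaves p, i ∉ x.path ∧ x.path.Nodup := fun x hx => by
      simpa using hT ⟨(1 - p i) * x.prob, i :: x.path, x.active⟩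
        (by simp only [StrategyTree.leaves, List.mem_append, List.mem_map]; exact .inr ⟨x, hx, rfl⟩)
    obtain ⟨u, hu⟩ := hY (fun x hx => (hYn x hx).2) (fun A => W (insert i A))
    obtain ⟨v, hv⟩ := hN (fun x hx => (hNn x hx).2) W
    clear hY hN hT
    have q0 := h0 i
    have q1 := h1 i
    have q1' : 0 ≤ 1 - p i := sub_nonneg.2 q1
    set q := p i with hq
    -- Paths do not repeat `i`, so both subtree laws live on sets avoiding `i`.
    have uz : ∀ S C, i ∈ S → u S C = 0 := fun S C hi => by
      by_contra h
      obtain ⟨x, hx, hS⟩ := hu.subset_path S C h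
      exact (hYn x hx).1 (List.mem_toFinset.1 (hS hi))
    have vz : ∀ S C, i ∈ S → v S C = 0 := fun S C hi => by
      by_contra h
      obtain ⟨x, hx, hS⟩ := hv.subset_path S C h
      exact (hNn x hx).1 (List.mem_toFinset.1 (hS hi))
    set a : Finset (Fin n) → ℝ := fun S => ∑ C, u S C with ha
    set b : Finset (Fin n) → ℝ := fun S => ∑ C, v S C with hb
    set m : Finset (Fin n) → ℝ := fun S => ∑ C, if i ∈ C then u S C else 0 with hm
    have a0 : ∀ S, 0 ≤ a S := fun S => sum_nonneg fun C _ => hu.nonneg S C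
    have b0 : ∀ S, 0 ≤ b S := fun S => sum_nonneg fun C _ => hv.nonneg S C
    have m0 : ∀ S, 0 ≤ m S := fun S => sum_nonneg fun C _ => by
      split_ifs <;> simp [hu.nonneg S C]
    have ma : ∀ S, m S ≤ a S := fun S => sum_le_sum fun C _ => by
      split_ifs <;> simp [hu.nonneg S C]
    have az : ∀ S, i ∈ S → a S = 0 := fun S hi => sum_eq_zero fun C _ => uz S C hi
    have bz : ∀ S, i ∈ S → b S = 0 := fun S hi => sum_eq_zero fun C _ => vz S C hi
    have mz : ∀ S, i ∈ S → m S = 0 := fun S hi =>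
      le_antisymm ((ma S).trans (az S hi).le) (m0 S)
    set c : Finset (Fin n) → ℝ := fun S => q * a S + (1 - q) * b S with hc
    have c0 : ∀ S, 0 ≤ c S := fun S =>
      add_nonneg (mul_nonneg q0 (a0 S)) (mul_nonneg q1' (b0 S))
    set t : Finset (Fin n) → ℝ := fun S => min (m S) (c S) with ht
    have t0 : ∀ S, 0 ≤ t S := fun S => le_min (m0 S) (c0 S)
    -- If `m S = 0` the quotient is 0 by convention, and `t S = 0` as well, so `β S * m S = t S`
    -- always holds.
    set β : Finset (Fin n) → ℝ := fun S => t S / m S with hβ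
    have β0 : ∀ S, 0 ≤ β S := fun S => div_nonneg (t0 S) (m0 S)
    have β1 : ∀ S, β S ≤ 1 := fun S => div_le_one_of_le₀ (min_le_left _ _) (m0 S)
    have βm : ∀ S, β S * m S = t S := fun S => by
      rcases (m0 S).eq_or_lt with h | h
      · have : t S = 0 := le_antisymm ((min_le_left _ _).trans h.ge) (t0 S)
        rw [this, ← h, mul_zero]
      · exact div_mul_cancel₀ _ h.ne'
    have acc : ∀ S, ∑ C, (if i ∈ C then q * β S * u S C else 0) = q * t S := fun S => by
      rw [← βm S, hm, mul_sum, mul_sum]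
      refine sum_congr rfl fun C _ => ?_
      split_ifs <;> ring
    have acc_le : ∀ S C, (if i ∈ C then q * β S * u S C else 0) ≤ q * u S C := fun S C => by
      have := mul_nonneg q0 (hu.nonneg S C)
      split_ifs
      · have := mul_le_mul_of_nonneg_right (β1 S) this
        linarith
      · exact this
    have memQ : ∀ S, S ∈ (univ.erase i).powerset → i ∉ S := fun S hS h =>
      notMem_erase i univ (mem_powerset.1 hS h)
    have ν1 : ∀ S, i ∉ S → ∑ C, nodeLaw q i β u v S C = c S - q * t S := fun S hS => by
      simp only [nodeLaw, if_neg hS, sum_sub_distrib, sum_add_distrib, ← mul_sum, acc]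
      rfl
    have ν2 : ∀ S, i ∉ S → ∑ C, nodeLaw q i β u v (insert i S) C = q * t S := fun S hS => by
      simp only [nodeLaw, if_pos (mem_insert_self i S), erase_insert hS, acc]
    have tc : ∀ S, q * t S ≤ c S := fun S =>
      (mul_le_of_le_one_left (t0 S) q1).trans (min_le_right _ _)
    refine ⟨nodeLaw q i β u v, ?_, ?_, ?_, ?_, ?_, ?_, ?_⟩
    · intro S C
      unfold nodeLaw
      split_ifs with h h' h'
      · exact mul_nonneg (mul_nonneg q0 (β0 _)) (hu.nonneg _ _)
      · exact le_rfl
      · have := acc_le S C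
        rw [if_pos h'] at this
        have := mul_nonneg q1' (hv.nonneg S C)
        linarith
      · have := mul_nonneg q1' (hv.nonneg S C)
        have := mul_nonneg q0 (hu.nonneg S C)
        linarith
    · intro S C h
      unfold nodeLaw at h
      split_ifs at h with h1 h2 h2
      · have := hu.subset _ _ (right_ne_zero_of_mul h)
        rw [← insert_erase h1]
        exact insert_subset h2 this
      · exact absurd rfl h
      all_goals
        by_contra hSC
        have e1 : u S C = 0 := by_contra fun h => hSC (hu.subset _ _ h)
        have e2 : v S C = 0 := by_contra fun h => hSC (hv.subset _ _ h)
        simp [e1, e2] at h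
    · intro S C h
      unfold nodeLaw at h
      split_ifs at h with h1 h2 h2
      · obtain ⟨A, hA⟩ := hu.mem_range _ _ (right_ne_zero_of_mul h)
        exact ⟨_, hA⟩
      · exact absurd rfl h
      all_goals
        by_contra hSC
        have e1 : u S C = 0 := by_contra fun h => hSC
          (let ⟨A, hA⟩ := hu.mem_range _ _ h; ⟨_, hA⟩)
        have e2 : v S C = 0 := by_contra fun h => hSC (hv.mem_range _ _ h)
        simp [e1, e2] at h
    · intro S C h
      have hu' : ∀ S, u S C ≠ 0 → ∃ x ∈ (StrategyTree.node i Y N).leaves p,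
          insert i S ⊆ x.path.toFinset := fun S h => by
        obtain ⟨x, hx, hS⟩ := hu.subset_path _ _ h
        refine ⟨⟨p i * x.prob, i :: x.path, insert i x.active⟩, ?_, ?_⟩
        · simp only [StrategyTree.leaves, List.mem_append, List.mem_map]
          exact .inl ⟨x, hx, rfl⟩
        · simpa using insert_subset_insert i hS
      have hv' : ∀ S, v S C ≠ 0 → ∃ x ∈ (StrategyTree.node i Y N).leaves p,
          insert i S ⊆ x.path.toFinset := fun S h => by
        obtain ⟨x, hx, hS⟩ := hv.subset_path _ _ h
        refine ⟨⟨(1 - p i) * x.prob, i :: x.path, x.active⟩, ?_, ?_⟩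
        · simp only [StrategyTree.leaves, List.mem_append, List.mem_map]
          exact .inr ⟨x, hx, rfl⟩
        · simpa using insert_subset_insert i hS
      unfold nodeLaw at h
      split_ifs at h with h1 h2 h2
      · simpa [insert_erase h1] using hu' _ (right_ne_zero_of_mul h)
      · exact absurd rfl h
      all_goals
        by_contra hSC
        have e1 : u S C = 0 := by_contra fun h => hSC
          (let ⟨x, hx, hS⟩ := hu' _ h; ⟨x, hx, (subset_insert _ _).trans hS⟩)
        have e2 : v S C = 0 := by_contra fun h => hSC
          (let ⟨x, hx, hS⟩ := hv' _ h; ⟨x, hx, (subset_insert _ _).trans hS⟩)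
        simp [e1, e2] at h
    · intro C
      rw [StrategyTree.expect_node, ← hu.marginal, ← hv.marginal, sum_finset_eq i,
        sum_finset_eq_of_zero i (fun S => u S C) (fun S => uz S C),
        sum_finset_eq_of_zero i (fun S => v S C) (fun S => vz S C), mul_sum, mul_sum,
        ← sum_add_distrib]
      refine sum_congr rfl fun S hS => ?_
      simp only [nodeLaw, if_neg (memQ S hS), if_pos (mem_insert_self i S),
        erase_insert (memQ S hS)]
      ring
    · intro g hg
      set g' : Finset (Fin n) → ℝ := fun S => q * g (insert i S) + (1 - q) * g S with hg'
      have mono : Monotone g' := fun S S' h => add_le_add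
        (mul_le_mul_of_nonneg_left (hg (insert_subset_insert i h)) q0)
        (mul_le_mul_of_nonneg_left (hg h) q1')
      have e : (StrategyTree.node i Y N).expect p (fun P _ => probeExpect p g P.toFinset) =
          q * Y.expect p (fun P _ => probeExpect p g' P.toFinset) +
            (1 - q) * N.expect p (fun P _ => probeExpect p g' P.toFinset) := by
        rw [StrategyTree.expect_node]
        congr 2
        · refine StrategyTree.expect_congr _ fun x hx => ?_
          rw [List.toFinset_cons, probeExpect_insert]
          simpa using (hYn x hx).1
        · refine StrategyTree.expect_congr _ fun x hx => ?_
          rw [List.toFinset_cons, probeExpect_insert]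
          simpa using (hNn x hx).1
      rw [e]
      refine le_trans ?_ (add_le_add (mul_le_mul_of_nonneg_left (hu.dominated g' mono) q0)
        (mul_le_mul_of_nonneg_left (hv.dominated g' mono) q1'))
      rw [sum_finset_eq i,
        sum_finset_eq_of_zero i (fun S => (∑ C, u S C) * g' S)
          (fun S hS => by rw [show ∑ C, u S C = 0 from az S hS, zero_mul]),
        sum_finset_eq_of_zero i (fun S => (∑ C, v S C) * g' S)
          (fun S hS => by rw [show ∑ C, v S C = 0 from bz S hS, zero_mul]), mul_sum, mul_sum,
        ← sum_add_distrib]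
      refine sum_le_sum fun S hS => ?_
      rw [ν1 S (memQ S hS), ν2 S (memQ S hS)]
      have h1 : q * t S ≤ q * c S := mul_le_mul_of_nonneg_left (min_le_right _ _) q0
      have h2 : 0 ≤ g (insert i S) - g S := sub_nonneg.2 (hg (subset_insert i S))
      have h3 := mul_le_mul_of_nonneg_right h1 h2
      have h4 : q * (∑ C, u S C) + (1 - q) * (∑ C, v S C) = c S := rfl
      calc _ = c S * g S + q * t S * (g (insert i S) - g S) := by ring
        _ ≤ c S * g S + q * c S * (g (insert i S) - g S) := by linarith
        _ = c S * g' S := by rw [hg']; ring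
        _ = _ := by rw [← h4]; ring
    -- The total of `m` is the probability, given that `i` is active, that the final label contains
    -- `i`: the contribution of this probe to the reward.
    · have hmθ : ∑ S, m S = Y.expect p (fun _ A => if i ∈ W (insert i A) then (1 : ℝ) else 0) := by
        have : ∀ A, (if i ∈ W (insert i A) then (1 : ℝ) else 0) =
            ∑ C, if i ∈ C then (if W (insert i A) = C then 1 else 0) else 0 := fun A => by
          rw [← sum_filter, sum_ite_eq]
          simp
        simp only [this]
        rw [StrategyTree.expect_sum, hm, sum_comm]
        refine sum_congr rfl fun C _ => ?_
        by_cases h : i ∈ C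
        · simp only [h, if_true]
          exact hu.marginal C
        · simpa [h] using (StrategyTree.expect_const p Y 0).symm
      have e : (StrategyTree.node i Y N).expect p (fun _ A => ((A ∩ W A).card : ℝ)) =
          q * ∑ S, m S +
          (q * Y.expect p (fun _ A => ((A ∩ W (insert i A)).card : ℝ)) +
            (1 - q) * N.expect p (fun _ A => ((A ∩ W A).card : ℝ))) := by
        rw [StrategyTree.expect_node, hmθ, ← add_assoc, ← mul_add, ← StrategyTree.expect_add]
        congr 2
        refine StrategyTree.expect_congr _ fun x hx => ?_
        have hi : i ∉ x.active := fun h =>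
          (hYn x hx).1 (List.mem_toFinset.1 (StrategyTree.active_subset_path Y x hx h))
        by_cases h : i ∈ W (insert i x.active)
        · rw [insert_inter_of_mem h, card_insert_of_notMem (fun h => hi (mem_inter.1 h).1), if_pos h]
          push_cast; ring
        · rw [insert_inter_of_notMem h, if_neg h, zero_add]
      have hu' := mul_le_mul_of_nonneg_left hu.entropy q0
      have hv' := mul_le_mul_of_nonneg_left hv.entropy q1'
      have key : l * (q * ∑ S, m S) + q * ∑ S, Real.negMulLog (a S) +
            (1 - q) * ∑ S, Real.negMulLog (b S) +
            (Real.exp l - 1) * (q * ∑ S, a S * (S.card : ℝ) + (1 - q) * ∑ S, b S * (S.card : ℝ)) ≤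
          ∑ S, Real.negMulLog (∑ C, nodeLaw q i β u v S C) +
            (Real.exp l - 1) * ∑ S, (∑ C, nodeLaw q i β u v S C) * (S.card : ℝ) := by
        rw [sum_finset_eq_of_zero i m mz,
          sum_finset_eq_of_zero i (fun S => Real.negMulLog (a S))
            (fun S hS => by rw [az S hS, Real.negMulLog_zero]),
          sum_finset_eq_of_zero i (fun S => Real.negMulLog (b S))
            (fun S hS => by rw [bz S hS, Real.negMulLog_zero]),
          sum_finset_eq_of_zero i (fun S => a S * (S.card : ℝ))
            (fun S hS => by rw [az S hS, zero_mul]),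
          sum_finset_eq_of_zero i (fun S => b S * (S.card : ℝ))
            (fun S hS => by rw [bz S hS, zero_mul]),
          sum_finset_eq i, sum_finset_eq i]
        simp only [mul_sum, ← sum_add_distrib]
        refine sum_le_sum fun S hS => ?_
        rw [ν1 S (memQ S hS), ν2 S (memQ S hS), card_insert_of_notMem (memQ S hS)]
        have h1 := entropy_step q0 q1 (b0 S) (m0 S) (ma S) hl
        have h2 := negMulLog_add_le (sub_nonneg.2 (tc S)) (mul_nonneg q0 (t0 S))
        rw [sub_add_cancel] at h2
        have h3 : q * a S + (1 - q) * b S = c S := rfl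
        have h4 : min (m S) (c S) = t S := rfl
        rw [h3, h4] at h1
        have h5 : (Real.exp l - 1) * (q * (a S * (S.card : ℝ)) + (1 - q) * (b S * (S.card : ℝ))) =
            (Real.exp l - 1) * (c S * S.card) := by rw [← h3]; ring
        push_cast
        nlinarith
      rw [e]
      simp only [mul_add] at hu' hv' key ⊢
      simp only [ha, hb] at key
      linarith

/-! ### Upper bound by entropy -/

theorem IsBinaryXOS.exists_argmax {f : Finset (Fin n) → ℝ} (hf : IsBinaryXOS f) :
    ∃ W : Finset (Fin n) → Finset (Fin n),
      (∀ A, f A = ((A ∩ W A).card : ℝ)) ∧ ∀ A S, ((S ∩ W A).card : ℝ) ≤ f S := by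
  obtain ⟨m, w, hw, hf⟩ := hf
  choose k hk using fun A => (hf A).1
  have h : ∀ i S, ∑ j ∈ S, w i j = ((S ∩ univ.filter fun j => w i j = 1).card : ℝ) := by
    intro i S
    rw [inter_filter, inter_univ, card_filter]
    push_cast
    refine sum_congr rfl fun j _ => ?_
    rcases hw i j with h | h <;> simp [h]
  refine ⟨fun A => univ.filter fun j => w (k A) j = 1, fun A => ?_, fun A S => ?_⟩
  · rw [← h, ← hk]
  · rw [← h]
    exact (hf S).2 ⟨k A, rfl⟩

/-- Gibbs' inequality against the weights `n ^ (-|S|)`. -/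
theorem sum_negMulLog_le (hn : 0 < n) {ν : Finset (Fin n) → ℝ} (h0 : ∀ S, 0 ≤ ν S)
    (h1 : ∑ S, ν S = 1) :
    ∑ S, Real.negMulLog (ν S) ≤ Real.log n * ∑ S, ν S * (S.card : ℝ) + 2 := by
  have hn' : (0 : ℝ) < n := Nat.cast_pos.2 hn
  have key : ∀ S, Real.negMulLog (ν S) ≤
      Real.log n * (ν S * (S.card : ℝ)) + ((n : ℝ)⁻¹ ^ S.card - ν S) := by
    intro S
    rcases (h0 S).eq_or_lt with h | h
    · rw [← h]; simp
    have hw : (0 : ℝ) < (n : ℝ)⁻¹ ^ S.card := by positivity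
    have := Real.log_le_sub_one_of_pos (div_pos hw h)
    rw [Real.log_div hw.ne' h.ne', Real.log_pow, Real.log_inv] at this
    have h2 := mul_le_mul_of_nonneg_left this h.le
    have h3 : ν S * ((n : ℝ)⁻¹ ^ S.card / ν S - 1) = (n : ℝ)⁻¹ ^ S.card - ν S := by field_simp
    unfold Real.negMulLog
    nlinarith
  -- The sum over all subsets factors as (1 + 1/n)^n ≤ e.
  have hsum : ∑ S : Finset (Fin n), (n : ℝ)⁻¹ ^ S.card ≤ 3 := by
    have h := Finset.prod_add (fun _ : Fin n => (n : ℝ)⁻¹) (fun _ => (1 : ℝ)) univ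
    simp only [prod_const, one_pow, mul_one, powerset_univ, card_univ, Fintype.card_fin] at h
    rw [← h]
    have h2 : (n : ℝ)⁻¹ + 1 ≤ Real.exp (n : ℝ)⁻¹ := Real.add_one_le_exp _
    calc _ ≤ Real.exp (n : ℝ)⁻¹ ^ n := by gcongr
      _ = Real.exp 1 := by rw [← Real.exp_nat_mul, mul_inv_cancel₀ hn'.ne']
      _ ≤ 3 := Real.exp_one_lt_three.le
  calc _ ≤ ∑ S, (Real.log n * (ν S * (S.card : ℝ)) + ((n : ℝ)⁻¹ ^ S.card - ν S)) :=
        sum_le_sum fun S _ => key S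
    _ = Real.log n * ∑ S, ν S * (S.card : ℝ) + (∑ S : Finset (Fin n), (n : ℝ)⁻¹ ^ S.card - 1) := by
        rw [sum_add_distrib, sum_sub_distrib, h1, mul_sum]
    _ ≤ _ := by linarith

/-- S lies inside a weight set, so |S| ≤ f(S); as f is monotone, domination yields E|S| ≤ α. The
entropy bound of the shadow law is then combined with Gibbs' inequality. -/
theorem mul_expect_le (hn : 0 < n) {p : Fin n → ℝ} (h0 : ∀ i, 0 ≤ p i) (h1 : ∀ i, p i ≤ 1)
    {f : Finset (Fin n) → ℝ} (hf : IsBinaryXOS f) {T : StrategyTree n}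
    (hT : ∀ x ∈ T.leaves p, x.path.Nodup) {α : ℝ}
    (hα : ∀ x ∈ T.leaves p, probeExpect p f x.path.toFinset ≤ α) {l : ℝ} (hl : 0 ≤ l) :
    l * T.expect p (fun _ A => f A) ≤ (Real.log n + (Real.exp l - 1)) * α + 2 := by
  obtain ⟨W, hW, hWf⟩ := hf.exists_argmax
  obtain ⟨ω, hω⟩ := exists_isShadowLaw h0 h1 hl T hT W
  have hν0 : ∀ S, 0 ≤ ∑ C, ω S C := fun S => sum_nonneg fun C _ => hω.nonneg S C
  have hν1 : ∑ S, ∑ C, ω S C = 1 := by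
    rw [sum_comm]
    simp only [hω.marginal]
    rw [← StrategyTree.expect_sum]
    simpa using StrategyTree.expect_const p T 1
  have hmono : Monotone f := fun S S' h => by
    rw [hW S]
    refine le_trans ?_ (hWf S S')
    exact_mod_cast card_le_card (inter_subset_inter_right h)
  have hcard : ∑ S, (∑ C, ω S C) * (S.card : ℝ) ≤ α := by
    refine le_trans (sum_le_sum fun S _ => ?_) ((hω.dominated f hmono).trans ?_)
    · rw [sum_mul, sum_mul]
      refine sum_le_sum fun C _ => ?_
      by_cases h : ω S C = 0
      · simp [h]
      refine mul_le_mul_of_nonneg_left ?_ (hω.nonneg S C)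
      obtain ⟨A, rfl⟩ := hω.mem_range S C h
      simpa [inter_eq_left.2 (hω.subset S _ h)] using hWf A S
    · rw [← StrategyTree.expect_const p T α]
      exact StrategyTree.expect_mono h0 h1 T hα
  have hent := hω.entropy
  simp only [← hW] at hent
  have hg := sum_negMulLog_le hn hν0 hν1
  have hexp : 0 ≤ Real.exp l - 1 := by linarith [Real.add_one_le_exp l]
  have hlog : 0 ≤ Real.log n := Real.log_natCast_nonneg n
  nlinarith [mul_le_mul_of_nonneg_left hcard hexp, mul_le_mul_of_nonneg_left hcard hlog]

/-! ### Upper bound for small non-adaptive reward -/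

/-- Whether an element gets probed is decided before its outcome is seen, so each probe contributes
its activation probability in expectation. -/
theorem expect_card_inter (p : Fin n → ℝ) (V : Finset (Fin n)) (T : StrategyTree n)
    (hT : ∀ x ∈ T.leaves p, x.path.Nodup) :
    T.expect p (fun _ A => ((A ∩ V).card : ℝ)) =
      T.expect p (fun P _ => ∑ i ∈ P.toFinset ∩ V, p i) := by
  induction T with
  | leaf => simp [StrategyTree.expect_leaf]
  | node i Y N hY hN =>
    have hYn : ∀ x ∈ Y.leaves p, i ∉ x.path ∧ x.path.Nodup := fun x hx => by
      simpa using hT ⟨p i * x.prob, i :: x.path, insert i x.active⟩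
        (by simp only [StrategyTree.leaves, List.mem_append, List.mem_map]; exact .inl ⟨x, hx, rfl⟩)
    have hNn : ∀ x ∈ N.leaves p, i ∉ x.path ∧ x.path.Nodup := fun x hx => by
      simpa using hT ⟨(1 - p i) * x.prob, i :: x.path, x.active⟩
        (by simp only [StrategyTree.leaves, List.mem_append, List.mem_map]; exact .inr ⟨x, hx, rfl⟩)
    have hY := hY fun x hx => (hYn x hx).2
    have hN := hN fun x hx => (hNn x hx).2
    have hs : ∀ P : List (Fin n), i ∉ P → ∑ j ∈ (i :: P).toFinset ∩ V, p j =
        (if i ∈ V then p i else 0) + ∑ j ∈ P.toFinset ∩ V, p j := fun P hP => by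
      rw [List.toFinset_cons]
      by_cases h : i ∈ V
      · rw [insert_inter_of_mem h, sum_insert (by simp [hP]), if_pos h]
      · rw [insert_inter_of_notMem h, if_neg h, zero_add]
    have hc : ∀ x ∈ Y.leaves p, ((insert i x.active ∩ V).card : ℝ) =
        (if i ∈ V then 1 else 0) + ((x.active ∩ V).card : ℝ) := fun x hx => by
      have hi : i ∉ x.active := fun h =>
        (hYn x hx).1 (List.mem_toFinset.1 (StrategyTree.active_subset_path Y x hx h))
      by_cases h : i ∈ V
      · rw [insert_inter_of_mem h, card_insert_of_notMem (by simp [hi]), if_pos h]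
        push_cast; ring
      · rw [insert_inter_of_notMem h, if_neg h, zero_add]
    rw [StrategyTree.expect_node, StrategyTree.expect_node,
      StrategyTree.expect_congr Y (g := fun P A => ((insert i A ∩ V).card : ℝ))
        (h := fun P A => (if i ∈ V then (1 : ℝ) else 0) + ((A ∩ V).card : ℝ)) hc,
      StrategyTree.expect_congr Y
        (g := fun P _ => ∑ j ∈ (i :: P).toFinset ∩ V, p j)
        (h := fun P _ => (if i ∈ V then p i else 0) + ∑ j ∈ P.toFinset ∩ V, p j)
        (fun x hx => hs _ (hYn x hx).1),
      StrategyTree.expect_congr N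
        (g := fun P _ => ∑ j ∈ (i :: P).toFinset ∩ V, p j)
        (h := fun P _ => (if i ∈ V then p i else 0) + ∑ j ∈ P.toFinset ∩ V, p j)
        (fun x hx => hs _ (hNn x hx).1),
      StrategyTree.expect_add, StrategyTree.expect_add, StrategyTree.expect_add,
      StrategyTree.expect_const, StrategyTree.expect_const, StrategyTree.expect_const, hY, hN]
    split_ifs <;> ring

theorem probeExpect_mono {p : Fin n → ℝ} (h0 : ∀ i, 0 ≤ p i) (h1 : ∀ i, p i ≤ 1)
    {g h : Finset (Fin n) → ℝ} {P : Finset (Fin n)} (H : ∀ S ⊆ P, g S ≤ h S) :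
    probeExpect p g P ≤ probeExpect p h P :=
  sum_le_sum fun S hS => mul_le_mul_of_nonneg_left (H S (mem_powerset.1 hS))
    (mul_nonneg (prod_nonneg fun i _ => h0 i) (prod_nonneg fun i _ => sub_nonneg.2 (h1 i)))

/-- The complementary event is that no element of P ∩ V is active; both terms come from expanding
products of sums over subsets of P. -/
theorem probeExpect_indicator (p : Fin n → ℝ) (V P : Finset (Fin n)) :
    probeExpect p (fun S => if (S ∩ V).Nonempty then 1 else 0) P =
      1 - ∏ i ∈ P ∩ V, (1 - p i) := by
  have h1 := Finset.prod_add p (fun i => 1 - p i) P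
  have h2 := Finset.prod_add (fun i => if i ∈ V then 0 else p i) (fun i => 1 - p i) P
  simp only [add_sub_cancel, prod_const_one] at h1
  have h3 : ∏ i ∈ P ∩ V, (1 - p i) = ∏ i ∈ P, ((if i ∈ V then 0 else p i) + (1 - p i)) := by
    rw [← filter_mem_eq_inter, prod_filter]
    exact prod_congr rfl fun i _ => by split_ifs <;> ring
  rw [h3, h2]
  conv_rhs => enter [1]; rw [h1]
  rw [← sum_sub_distrib]
  refine sum_congr rfl fun S _ => ?_
  dsimp only
  split_ifs with h
  · obtain ⟨j, hj⟩ := h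
    have : ∏ i ∈ S, (if i ∈ V then 0 else p i) = 0 :=
      prod_eq_zero (mem_inter.1 hj).1 (if_pos (mem_inter.1 hj).2)
    rw [this]
    ring
  · rw [prod_congr rfl (g := p) fun j hj => if_neg fun hV => h ⟨j, mem_inter.2 ⟨hj, hV⟩⟩]
    ring

theorem one_add_sum_mul_prod_le {ι : Type*} (s : Finset ι) {x : ι → ℝ} (h0 : ∀ i, 0 ≤ x i)
    (h1 : ∀ i, x i ≤ 1) : (1 + ∑ i ∈ s, x i) * ∏ i ∈ s, (1 - x i) ≤ 1 := by
  classical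
  induction s using Finset.induction_on with
  | empty => simp
  | insert a s ha ih =>
    rw [sum_insert ha, prod_insert ha]
    have hp : 0 ≤ ∏ i ∈ s, (1 - x i) := prod_nonneg fun i _ => sub_nonneg.2 (h1 i)
    have hs : 0 ≤ ∑ i ∈ s, x i := sum_nonneg fun i _ => h0 i
    have : (1 + (x a + ∑ i ∈ s, x i)) * (1 - x a) ≤ 1 + ∑ i ∈ s, x i := by
      nlinarith [mul_nonneg (h0 a) hs, mul_self_nonneg (x a)]
    nlinarith [mul_le_mul_of_nonneg_right this hp]

/-- With V the union of the weight sets, 1[S ∩ V ≠ ∅] ≤ f(S) ≤ |S ∩ V|. If s is the total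
probability of V on a path, the left inequality gives s/(1+s) ≤ α, hence s ≤ 2α when α ≤ 1/2; the
right one bounds the adaptive reward by the mean of s. -/
theorem expect_le_two_mul {p : Fin n → ℝ} (h0 : ∀ i, 0 ≤ p i) (h1 : ∀ i, p i ≤ 1)
    {f : Finset (Fin n) → ℝ} (hf : IsBinaryXOS f) {T : StrategyTree n}
    (hT : ∀ x ∈ T.leaves p, x.path.Nodup) {α : ℝ} (hα1 : α ≤ 1 / 2)
    (hα : ∀ x ∈ T.leaves p, probeExpect p f x.path.toFinset ≤ α) :
    T.expect p (fun _ A => f A) ≤ 2 * α := by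
  obtain ⟨W, hW, hWf⟩ := hf.exists_argmax
  set V : Finset (Fin n) := univ.biUnion W with hV
  have hfV : ∀ A, f A ≤ ((A ∩ V).card : ℝ) := fun A => by
    rw [hW A]
    exact_mod_cast card_le_card
      (inter_subset_inter_left (subset_biUnion_of_mem W (mem_univ A)))
  have hVf : ∀ S, (if (S ∩ V).Nonempty then (1 : ℝ) else 0) ≤ f S := fun S => by
    split_ifs with h
    · obtain ⟨j, hj⟩ := h
      obtain ⟨hjS, hjV⟩ := mem_inter.1 hj
      obtain ⟨A, -, hA⟩ := mem_biUnion.1 hjV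
      refine le_trans ?_ (hWf A S)
      exact_mod_cast card_pos.2 ⟨j, mem_inter.2 ⟨hjS, hA⟩⟩
    · rw [hW]; positivity
  calc T.expect p (fun _ A => f A) ≤ T.expect p (fun _ A => ((A ∩ V).card : ℝ)) :=
        StrategyTree.expect_mono h0 h1 T fun x _ => hfV _
    _ = T.expect p (fun P _ => ∑ i ∈ P.toFinset ∩ V, p i) := expect_card_inter p V T hT
    _ ≤ T.expect p (fun _ _ => 2 * α) := by
        refine StrategyTree.expect_mono h0 h1 T fun x hx => ?_
        have e1 := (probeExpect_mono h0 h1 (P := x.path.toFinset) fun S _ => hVf S).trans (hα x hx)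
        rw [probeExpect_indicator] at e1
        have e2 := one_add_sum_mul_prod_le (x.path.toFinset ∩ V) h0 h1
        have e3 : 0 ≤ ∑ i ∈ x.path.toFinset ∩ V, p i := sum_nonneg fun i _ => h0 i
        nlinarith
    _ = 2 * α := StrategyTree.expect_const p T _

/-! ### The upper bound on the gap -/

theorem expect_le_of_probeExpect_le (hn : 1 ≤ Real.log (Real.log n)) {p : Fin n → ℝ}
    (h0 : ∀ i, 0 ≤ p i) (h1 : ∀ i, p i ≤ 1)
    {f : Finset (Fin n) → ℝ} (hf : IsBinaryXOS f) {T : StrategyTree n}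
    (hT : ∀ x ∈ T.leaves p, x.path.Nodup) {α : ℝ} (hα0 : 0 ≤ α)
    (hα : ∀ x ∈ T.leaves p, probeExpect p f x.path.toFinset ≤ α) :
    T.expect p (fun _ A => f A) ≤ 6 * (Real.log n / Real.log (Real.log n)) * α := by
  have hlog : 0 < Real.log n := by
    refine (Real.log_natCast_nonneg n).lt_of_ne' fun h => ?_
    rw [h, Real.log_zero] at hn
    linarith
  have hn0 : 0 < n := Nat.pos_of_ne_zero fun h => by simp [h] at hlog
  have hll : Real.log (Real.log n) ≤ Real.log n - 1 := Real.log_le_sub_one_of_pos hlog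
  have hll0 : 0 < Real.log (Real.log n) := by linarith
  rw [mul_div_assoc', div_mul_eq_mul_div, le_div_iff₀ hll0]
  rcases le_total α (1 / 2) with h | h
  · have := expect_le_two_mul h0 h1 hf hT h hα
    nlinarith [mul_le_mul_of_nonneg_right this hll0.le, mul_le_mul_of_nonneg_left hll hα0,
      mul_nonneg hα0 hlog.le]
  -- With l = log log n, e^l equals log n and balances the entropy term; α ≥ 1/2 absorbs the
  -- additive 2.
  · have := mul_expect_le hn0 h0 h1 hf hT hα hll0.le
    rw [Real.exp_log hlog] at this
    nlinarith [mul_le_mul_of_nonneg_left h hlog.le]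

theorem adaptivityGap_le (hn : 1 ≤ Real.log (Real.log n)) (I : Instance n)
    {f : Finset (Fin n) → ℝ} (hf : IsBinaryXOS f) :
    I.adaptivityGap f ≤ ENNReal.ofReal (6 * (Real.log n / Real.log (Real.log n))) := by
  have hfin : I.feasible.Finite :=
    (List.finite_length_le (Fin n) n).subset fun σ hσ => by
      simpa using (I.nodup σ hσ).length_le_card
  obtain ⟨τ, hτ, hmax⟩ := Set.exists_max_image I.feasible
    (fun σ => I.nonadap f σ.toFinset) hfin ⟨[], I.nil_mem⟩
  obtain ⟨W, hW, -⟩ := hf.exists_argmax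
  have hα0 : 0 ≤ I.nonadap f τ.toFinset := by
    refine le_trans ?_ (hmax [] I.nil_mem)
    simp [Instance.nonadap, hW]
  refine ENNReal.div_le_of_le_mul (iSup₂_le fun T hT => ?_)
  have h := expect_le_of_probeExpect_le hn I.p_nonneg I.p_le_one hf
    (fun x hx => I.nodup _ (hT x hx)) hα0 (fun x hx => hmax _ (hT x hx))
  calc ENNReal.ofReal (I.adap f T)
      ≤ ENNReal.ofReal (6 * (Real.log n / Real.log (Real.log n)) * I.nonadap f τ.toFinset) :=
        ENNReal.ofReal_le_ofReal h
    _ = ENNReal.ofReal (6 * (Real.log n / Real.log (Real.log n))) *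
          ENNReal.ofReal (I.nonadap f τ.toFinset) := ENNReal.ofReal_mul' hα0
    _ ≤ _ := mul_le_mul_right (le_iSup₂ (f := fun (σ : List (Fin n)) (_ : σ ∈ I.feasible) =>
          ENNReal.ofReal (I.nonadap f σ.toFinset)) τ hτ) _

/-! ### Lower bound: walking down a k-ary tree -/

/-- Probe the children `j - 1, …, 0` of the word `w` until one of them is active, and continue with
the strategy of that child (with that of the child `0` if none is active). -/
def stem (e : List ℕ → Fin n) (w : List ℕ) (sub : ℕ → StrategyTree n) : ℕ → StrategyTree n
  | 0 => sub 0
  | j + 1 => .node (e (j :: w)) (sub j) (stem e w sub j)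

/-- The adaptive strategy that walks down a `k`-ary tree of depth `d` below the word `w`. -/
def walk (k : ℕ) (e : List ℕ → Fin n) : ℕ → List ℕ → StrategyTree n
  | 0, _ => .leaf
  | d + 1, w => stem e w (fun j => walk k e d (j :: w)) k

/-- The sets of elements on the downward paths of length `d` below the word `w`. -/
def downPaths (k : ℕ) (e : List ℕ → Fin n) : ℕ → List ℕ → Finset (Finset (Fin n))
  | 0, _ => {∅}
  | d + 1, w => (range k).biUnion fun c =>
      (downPaths k e d (c :: w)).image fun C => insert (e (c :: w)) C

/-- The largest intersection with a member of a family. -/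
def familyRank (𝒲 : Finset (Finset (Fin n))) (S : Finset (Fin n)) : ℕ :=
  𝒲.sup fun C => (S ∩ C).card

theorem isBinaryXOS_familyRank {𝒲 : Finset (Finset (Fin n))} (h : 𝒲.Nonempty) :
    IsBinaryXOS fun S => (familyRank 𝒲 S : ℝ) := by
  refine ⟨𝒲.card, fun i j => if j ∈ (𝒲.equivFin.symm i : Finset (Fin n)) then 1 else 0,
    fun i j => by dsimp only; split_ifs <;> simp, fun S => ?_⟩
  have hs : ∀ C : Finset (Fin n), ∑ j ∈ S, (if j ∈ C then (1 : ℝ) else 0) = ((S ∩ C).card : ℝ) :=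
    fun C => by simp
  simp only [hs]
  constructor
  · obtain ⟨C, hC, hmax⟩ := exists_mem_eq_sup 𝒲 h fun C => (S ∩ C).card
    exact ⟨𝒲.equivFin ⟨C, hC⟩, by simp [familyRank, hmax]⟩
  · rintro _ ⟨i, rfl⟩
    exact Nat.cast_le.2 (le_sup (f := fun C => (S ∩ C).card) (𝒲.equivFin.symm i).2)

theorem downPaths_nonempty {k : ℕ} (hk : 0 < k) (e : List ℕ → Fin n) (d : ℕ) (w : List ℕ) :
    (downPaths k e d w).Nonempty := by
  induction d generalizing w with
  | zero => simp [downPaths]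
  | succ d ih =>
    rw [downPaths, biUnion_nonempty]
    exact ⟨0, mem_range.2 hk, (ih _).image _⟩

theorem StrategyTree.leaves_ne_nil (p : Fin n → ℝ) (T : StrategyTree n) : T.leaves p ≠ [] := by
  induction T with
  | leaf => simp [leaves]
  | node i Y N hY _ => simp [leaves, hY]

theorem StrategyTree.forall_leaves_node {p : Fin n → ℝ} {i : Fin n} {Y N : StrategyTree n}
    {Q : List (Fin n) → Prop} :
    (∀ x ∈ (StrategyTree.node i Y N).leaves p, Q x.path) ↔
      (∀ x ∈ Y.leaves p, Q (i :: x.path)) ∧ ∀ x ∈ N.leaves p, Q (i :: x.path) := by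
  simp [leaves, or_imp, forall_and]

/-- The child `c` is where the spine continues; everything else on the path is a child of `w`. -/
theorem exists_of_mem_stem (p : Fin n → ℝ) (e : List ℕ → Fin n) (w : List ℕ)
    (sub : ℕ → StrategyTree n) {k : ℕ} (hk : 0 < k) {j : ℕ} (hj : j ≤ k) :
    ∀ x ∈ (stem e w sub j).leaves p, ∃ c < k, ∃ x' ∈ (sub c).leaves p,
      ∀ y ∈ x.path, y ∈ x'.path ∨ ∃ a < k, y = e (a :: w) := by
  induction j with
  | zero => exact fun x hx => ⟨0, hk, x, hx, fun y hy => .inl hy⟩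
  | succ j ih =>
    refine StrategyTree.forall_leaves_node (Q := fun P => ∃ c < k, ∃ x' ∈ (sub c).leaves p,
      ∀ y ∈ P, y ∈ x'.path ∨ ∃ a < k, y = e (a :: w)) |>.2 ⟨fun x hx => ?_, fun x hx => ?_⟩
    · refine ⟨j, hj, x, hx, fun y hy => ?_⟩
      rcases List.mem_cons.1 hy with rfl | hy
      exacts [.inr ⟨j, hj, rfl⟩, .inl hy]
    · obtain ⟨c, hc, x', hx', h⟩ := ih (Nat.le_of_succ_le hj) x hx
      refine ⟨c, hc, x', hx', fun y hy => ?_⟩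
      rcases List.mem_cons.1 hy with rfl | hy
      exacts [.inr ⟨j, hj, rfl⟩, h y hy]

theorem mem_walk_path (p : Fin n → ℝ) {k : ℕ} (hk : 0 < k) (e : List ℕ → Fin n) (d : ℕ)
    (w : List ℕ) : ∀ x ∈ (walk k e d w).leaves p, ∀ y ∈ x.path,
      ∃ t : List ℕ, t ≠ [] ∧ t.length ≤ d ∧ (∀ a ∈ t, a < k) ∧ y = e (t ++ w) := by
  induction d generalizing w with
  | zero => simp [walk, StrategyTree.leaves]
  | succ d ih =>
    intro x hx y hy
    obtain ⟨c, hc, x', hx', h⟩ := exists_of_mem_stem p e w _ hk le_rfl x hx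
    rcases h y hy with h | ⟨a, ha, rfl⟩
    · obtain ⟨t, -, ht, htk, rfl⟩ := ih (c :: w) x' hx' y h
      refine ⟨t ++ [c], by simp, by simpa using ht, fun a ha => ?_, by simp⟩
      rcases List.mem_append.1 ha with ha | ha
      · exact htk a ha
      · rw [List.mem_singleton.1 ha]; exact hc
    · exact ⟨[a], by simp, by simp, by simpa using ha, rfl⟩

theorem mem_downPaths {k : ℕ} (e : List ℕ → Fin n) (d : ℕ) (w : List ℕ) :
    ∀ C ∈ downPaths k e d w, ∀ y ∈ C,
      ∃ t : List ℕ, t ≠ [] ∧ t.length ≤ d ∧ (∀ a ∈ t, a < k) ∧ y = e (t ++ w) := by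
  induction d generalizing w with
  | zero => simp [downPaths]
  | succ d ih =>
    intro C hC y hy
    obtain ⟨c, hc, hC⟩ := mem_biUnion.1 hC
    obtain ⟨C', hC', rfl⟩ := mem_image.1 hC
    have hc := mem_range.1 hc
    rcases mem_insert.1 hy with rfl | hy
    · exact ⟨[c], by simp, by simp, by simpa using hc, rfl⟩
    · obtain ⟨t, -, ht, htk, rfl⟩ := ih (c :: w) C' hC' y hy
      refine ⟨t ++ [c], by simp, by simpa using ht, fun a ha => ?_, by simp⟩
      rcases List.mem_append.1 ha with ha | ha
      · exact htk a ha
      · rw [List.mem_singleton.1 ha]; exact hc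

/-- Words over `k` letters of length at most `D`. -/
def words (k D : ℕ) : Set (List ℕ) := {w | w.length ≤ D ∧ ∀ a ∈ w, a < k}

theorem append_cons_mem_words {k D d : ℕ} {t w : List ℕ} {c : ℕ} (hw : w ∈ words k D)
    (hd : d + 1 + w.length ≤ D) (ht : t.length ≤ d) (htk : ∀ a ∈ t, a < k) (hc : c < k) :
    t ++ c :: w ∈ words k D := by
  refine ⟨by simp; omega, fun a ha => ?_⟩
  simp only [List.mem_append, List.mem_cons] at ha
  rcases ha with ha | rfl | ha
  exacts [htk a ha, hc, hw.2 a ha]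

theorem nodup_walk (p : Fin n → ℝ) {k : ℕ} (hk : 0 < k) {e : List ℕ → Fin n} {D : ℕ}
    (he : Set.InjOn e (words k D)) (d : ℕ) (w : List ℕ) (hw : w ∈ words k D)
    (hd : d + w.length ≤ D) : ∀ x ∈ (walk k e d w).leaves p, x.path.Nodup := by
  induction d generalizing w with
  | zero => simp [walk, StrategyTree.leaves]
  | succ d ih =>
    have hcw : ∀ c < k, c :: w ∈ words k D := fun c hc =>
      append_cons_mem_words (t := []) hw hd (Nat.zero_le _) (by simp) hc
    have hsub : ∀ c < k, ∀ x ∈ (walk k e d (c :: w)).leaves p, x.path.Nodup := fun c hc =>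
      ih (c :: w) (hcw c hc) (by simp; omega)
    -- The invariant says that the stem from `j` meets only children below `j` and strictly deeper
    -- words, so the next probe, child `j`, is new.
    have main : ∀ j ≤ k, ∀ x ∈ (stem e w (fun j => walk k e d (j :: w)) j).leaves p,
        x.path.Nodup ∧ ∀ y ∈ x.path, ∃ (t : List ℕ) (c : ℕ), t.length ≤ d ∧ (∀ a ∈ t, a < k) ∧
          c < k ∧ (c < j ∨ t ≠ []) ∧ y = e (t ++ c :: w) := by
      intro j
      induction j with
      | zero =>
        intro _ x hx
        refine ⟨hsub 0 hk x hx, fun y hy => ?_⟩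
        obtain ⟨t, ht, h1, h2, rfl⟩ := mem_walk_path p hk e d _ x hx y hy
        exact ⟨t, 0, h1, h2, hk, .inr ht, rfl⟩
      | succ j ihj =>
        intro hj
        have aux : ∀ P : List (Fin n), P.Nodup → (∀ y ∈ P, ∃ (t : List ℕ) (c : ℕ), t.length ≤ d ∧
            (∀ a ∈ t, a < k) ∧ c < k ∧ (c < j ∨ t ≠ []) ∧ y = e (t ++ c :: w)) →
            (e (j :: w) :: P).Nodup ∧ ∀ y ∈ e (j :: w) :: P, ∃ (t : List ℕ) (c : ℕ),
              t.length ≤ d ∧ (∀ a ∈ t, a < k) ∧ c < k ∧ (c < j + 1 ∨ t ≠ []) ∧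
              y = e (t ++ c :: w) := by
          intro P hP h
          refine ⟨List.nodup_cons.2 ⟨fun hmem => ?_, hP⟩, fun y hy => ?_⟩
          · obtain ⟨t, c, h1, h2, h3, h4, h5⟩ := h _ hmem
            have := he (hcw j hj) (append_cons_mem_words hw hd h1 h2 h3) h5
            cases t with
            | nil => simp at this h4; omega
            | cons a t =>
              have := congrArg List.length this
              simp at this
              omega
          · rcases List.mem_cons.1 hy with rfl | hy
            · exact ⟨[], j, by simp, by simp, hj, .inl j.lt_succ_self, rfl⟩
            · obtain ⟨t, c, h1, h2, h3, h4, h5⟩ := h _ hy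
              exact ⟨t, c, h1, h2, h3, h4.imp_left fun h => h.trans j.lt_succ_self, h5⟩
        refine StrategyTree.forall_leaves_node (Q := fun P => P.Nodup ∧ ∀ y ∈ P,
          ∃ (t : List ℕ) (c : ℕ), t.length ≤ d ∧ (∀ a ∈ t, a < k) ∧ c < k ∧
            (c < j + 1 ∨ t ≠ []) ∧ y = e (t ++ c :: w)) |>.2 ⟨fun x hx => ?_, fun x hx => ?_⟩
        · refine aux _ (hsub j hj x hx) fun y hy => ?_
          obtain ⟨t, ht, h1, h2, rfl⟩ := mem_walk_path p hk e d _ x hx y hy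
          exact ⟨t, j, h1, h2, hj, .inr ht, rfl⟩
        · have := ihj (Nat.le_of_succ_le hj) x hx
          exact aux _ this.1 this.2
    exact fun x hx => (main k le_rfl x hx).1

/-- Along any fixed root-to-leaf path of the walk, the objective exceeds the number of active
elements on the spine by at most one. -/
theorem exists_spine (p : Fin n → ℝ) {k : ℕ} (hk : 0 < k) {e : List ℕ → Fin n} {D : ℕ}
    (he : Set.InjOn e (words k D)) (d : ℕ) (w : List ℕ) (hw : w ∈ words k D)
    (hd : d + w.length ≤ D) : ∀ x ∈ (walk k e d w).leaves p, ∃ L : List (Fin n), L.length ≤ d ∧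
      ∀ R ⊆ x.path.toFinset, ∀ C ∈ downPaths k e d w,
        (R ∩ C).card ≤ 1 + L.countP (fun y => y ∈ R) := by
  induction d generalizing w with
  | zero => intro x _; exact ⟨[], by simp, by simp [downPaths]⟩
  | succ d ih =>
    intro x hx
    obtain ⟨c, hc, x', hx', hpath⟩ := exists_of_mem_stem p e w _ hk le_rfl x hx
    obtain ⟨L, hL, hLR⟩ := ih (c :: w)
      (append_cons_mem_words (t := []) hw hd (Nat.zero_le _) (by simp) hc) (by simp; omega) x' hx'
    refine ⟨e (c :: w) :: L, by simpa using hL, fun R hR C hC => ?_⟩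
    obtain ⟨c', hc', hC⟩ := mem_biUnion.1 hC
    obtain ⟨C', hC', rfl⟩ := mem_image.1 hC
    have hc' := mem_range.1 hc'
    -- By injectivity of the labelling, a probed element two or more levels below `w` determines its
    -- ancestor among the children of `w`, which must be the spine child.
    have hRC : ∀ y ∈ R ∩ C', c' = c ∧ y ∈ x'.path := by
      intro y hy
      obtain ⟨hyR, hyC⟩ := mem_inter.1 hy
      obtain ⟨t, ht, h1, h2, rfl⟩ := mem_downPaths e d _ C' hC' y hyC
      have hmem := append_cons_mem_words hw hd h1 h2 hc'
      rcases hpath _ (List.mem_toFinset.1 (hR hyR)) with h | ⟨a, ha, h⟩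
      · refine ⟨?_, h⟩
        obtain ⟨t', -, h1', h2', h⟩ := mem_walk_path p hk e d _ x' hx' _ h
        have := he hmem (append_cons_mem_words hw hd h1' h2' hc) h
        have := List.append_inj_right' this (by simp)
        exact (List.cons.inj this).1
      · have := congrArg List.length (he hmem
          (append_cons_mem_words (t := []) hw hd (Nat.zero_le _) (by simp) ha) h)
        exact absurd (by simpa using this) ht
    by_cases hcc : c' = c
    · subst hcc
      have h1 : R ∩ C' ⊆ (R ∩ x'.path.toFinset) ∩ C' := fun y hy => by
        have := (hRC y hy).2
        simp_all
      have h2 := (card_le_card h1).trans (hLR _ inter_subset_right C' hC')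
      have h3 : L.countP (fun y => y ∈ R ∩ x'.path.toFinset) ≤ L.countP (fun y => y ∈ R) :=
        List.countP_mono_left fun y _ h => by
          simp only [decide_eq_true_eq, mem_inter] at h ⊢; exact h.1
      rw [List.countP_cons]
      by_cases hr : e (c' :: w) ∈ R
      · rw [inter_insert_of_mem hr]
        have := card_insert_le (e (c' :: w)) (R ∩ C')
        simp only [hr, decide_true, if_true]
        omega
      · rw [inter_insert_of_notMem hr]
        omega
    -- The downward path leaves the spine here: only its first node can count, which uses up the
    -- additive 1.
    · have h0 : R ∩ C' = ∅ := eq_empty_of_forall_notMem fun y hy => hcc (hRC y hy).1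
      have : R ∩ insert (e (c' :: w)) C' ⊆ insert (e (c' :: w)) (R ∩ C') := fun y hy => by
        simp only [mem_inter, mem_insert] at hy ⊢; tauto
      rw [h0] at this
      have := card_le_card this
      simp at this
      omega

theorem le_expect_walk {q : ℝ} (q0 : 0 ≤ q) (q1 : q ≤ 1) {k : ℕ} (hk : 0 < k)
    {e : List ℕ → Fin n} {D : ℕ} (he : Set.InjOn e (words k D)) (d : ℕ) (w : List ℕ)
    (hw : w ∈ words k D) (hd : d + w.length ≤ D) :
    d * (1 - (1 - q) ^ k) ≤
      (walk k e d w).expect (fun _ => q) (fun _ A => (familyRank (downPaths k e d w) A : ℝ)) := by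
  induction d generalizing w with
  | zero => simp [walk, StrategyTree.expect_leaf]
  | succ d ih =>
    have hcw : ∀ c < k, c :: w ∈ words k D := fun c hc =>
      append_cons_mem_words (t := []) hw hd (Nat.zero_le _) (by simp) hc
    have hsub := fun c (hc : c < k) => ih (c :: w) (hcw c hc) (by simp; omega)
    have hn := fun c (hc : c < k) => nodup_walk (fun _ => q) hk he d (c :: w) (hcw c hc)
      (by simp; omega)
    have hnd := nodup_walk (fun _ => q) hk he (d + 1) w hw hd
    have hrank : ∀ c < k, ∀ C ∈ downPaths k e d (c :: w), ∀ A : Finset (Fin n),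
        (A ∩ insert (e (c :: w)) C).card ≤ familyRank (downPaths k e (d + 1) w) A :=
      fun c hc C hC A => le_sup (f := fun C => (A ∩ C).card)
        (mem_biUnion.2 ⟨c, mem_range.2 hc, mem_image_of_mem _ hC⟩)
    -- With `j` children left to try, the current level succeeds with probability 1 - (1-q)^j, and
    -- the deeper levels earn at least d(1 - (1-q)^k) whichever child is entered.
    have main : ∀ j ≤ k, d * (1 - (1 - q) ^ k) + (1 - (1 - q) ^ j) ≤
        (stem e w (fun j => walk k e d (j :: w)) j).expect (fun _ => q)
          (fun _ A => (familyRank (downPaths k e (d + 1) w) A : ℝ)) := by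
      intro j
      induction j with
      | zero =>
        intro _
        rw [pow_zero, sub_self, add_zero]
        refine (hsub 0 hk).trans (StrategyTree.expect_mono (fun _ => q0) (fun _ => q1) _
          fun x _ => ?_)
        exact_mod_cast Finset.sup_le fun C hC =>
          (card_le_card (inter_subset_inter_left (subset_insert _ _))).trans (hrank 0 hk C hC _)
      | succ j ihj =>
        intro hj
        have hN := ihj (Nat.le_of_succ_le hj)
        have hY : d * (1 - (1 - q) ^ k) + 1 ≤ (walk k e d (j :: w)).expect (fun _ => q)
            (fun _ A => (familyRank (downPaths k e (d + 1) w) (insert (e (j :: w)) A) : ℝ)) := by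
          refine (add_le_add (hsub j hj)
            (StrategyTree.expect_const (fun _ => q) (walk k e d (j :: w)) 1).ge).trans ?_
          rw [← StrategyTree.expect_add]
          refine StrategyTree.expect_mono (fun _ => q0) (fun _ => q1) _ fun x hx => ?_
          have hnot : e (j :: w) ∉ x.active := fun h => by
            obtain ⟨t, ht, h1, h2, h⟩ := mem_walk_path _ hk e d _ x hx _
              (List.mem_toFinset.1 (StrategyTree.active_subset_path _ x hx h))
            have := congrArg List.length
              (he (hcw j hj) (append_cons_mem_words hw hd h1 h2 hj) h)
            exact ht (by simpa using this)
          obtain ⟨C, hC, hmax⟩ := exists_mem_eq_sup _ (downPaths_nonempty hk e d (j :: w))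
            fun C => (x.active ∩ C).card
          have h3 := hrank j hj C hC (insert (e (j :: w)) x.active)
          rw [← insert_inter_distrib, card_insert_of_notMem fun h => hnot (mem_inter.1 h).1] at h3
          rw [familyRank, hmax]
          exact_mod_cast h3
        rw [stem, StrategyTree.expect_node]
        have h1 := mul_le_mul_of_nonneg_left hY q0
        have h2 := mul_le_mul_of_nonneg_left hN (sub_nonneg.2 q1)
        rw [pow_succ]
        nlinarith
    have := main k le_rfl
    rw [walk]
    push_cast
    linarith

/-! ### The gap of the tree instance -/

theorem probeExpect_one_add_countP_le {p : Fin n → ℝ} (h0 : ∀ i, 0 ≤ p i) {q : ℝ}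
    (hq : ∀ i, p i ≤ q) (L : List (Fin n)) (P : Finset (Fin n)) :
    probeExpect p (fun S => 1 + (L.countP (fun y => y ∈ S) : ℝ)) P ≤ 1 + L.length * q := by
  induction L with
  | nil =>
    have h1 := Finset.prod_add p (fun i => 1 - p i) P
    simp only [add_sub_cancel, prod_const_one] at h1
    simp [probeExpect, ← h1]
  | cons y L ih =>
    have h := probeExpect_indicator p {y} P
    have h2 : 1 - ∏ i ∈ P ∩ {y}, (1 - p i) ≤ q := by
      by_cases hy : y ∈ P
      · rw [inter_singleton_of_mem hy]; simpa using hq y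
      · rw [inter_singleton_of_notMem hy]; simpa using (h0 y).trans (hq y)
    have h3 : probeExpect p (fun S => 1 + ((y :: L).countP (fun y => y ∈ S) : ℝ)) P =
        probeExpect p (fun S => 1 + (L.countP (fun y => y ∈ S) : ℝ)) P +
          probeExpect p (fun S => if (S ∩ {y}).Nonempty then 1 else 0) P := by
      unfold probeExpect
      rw [← sum_add_distrib]
      refine sum_congr rfl fun S _ => ?_
      dsimp only
      rw [List.countP_cons]
      by_cases hy : y ∈ S
      · simp [hy]; ring
      · simp [hy]
    rw [h3, h]
    push_cast [List.length_cons]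
    linarith

/-- The instance whose feasible sequences are the prefixes of the root-to-leaf paths of a tree. -/
def treeInstance (p : Fin n → ℝ) (h0 : ∀ i, 0 ≤ p i) (h1 : ∀ i, p i ≤ 1) (T : StrategyTree n)
    (hT : ∀ x ∈ T.leaves p, x.path.Nodup) : Instance n where
  p := p
  p_nonneg := h0
  p_le_one := h1
  feasible := {σ | ∃ x ∈ T.leaves p, σ <+: x.path}
  nodup := fun _ ⟨x, hx, h⟩ => (hT x hx).sublist h.sublist
  nil_mem := (List.exists_mem_of_ne_nil _ (T.leaves_ne_nil p)).imp fun _ hx =>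
    ⟨hx, List.nil_prefix⟩
  prefix_closed := fun _ ⟨x, hx, h⟩ _ h' => ⟨x, hx, h'.trans h⟩

/-- Words are read as numerals in base k+1. Letters are shifted by one so that no digit is zero and
words of different lengths stay distinct. -/
theorem exists_injOn_words {k : ℕ} (hn : (k + 1) ^ k ≤ n) :
    ∃ e : List ℕ → Fin n, Set.InjOn e (words k k) := by
  have hn0 : 0 < n := lt_of_lt_of_le (by positivity) hn
  have hlt : ∀ w ∈ words k k, Nat.ofDigits (k + 1) (w.map (· + 1)) < n := fun w hw => by
    have hk : 1 < k + 1 ∨ w = [] := by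
      rcases w with _ | ⟨a, w⟩
      · exact .inr rfl
      · have := hw.2 a (by simp)
        exact .inl (by omega)
    rcases hk with hk | rfl
    · refine (Nat.ofDigits_lt_base_pow_length hk fun x hx => ?_).trans_le
        (le_trans (Nat.pow_le_pow_right (by omega) ?_) hn)
      · obtain ⟨a, ha, rfl⟩ := List.mem_map.1 hx
        have := hw.2 a ha
        omega
      · simpa using hw.1
    · simpa using hn0
  refine ⟨fun w => ⟨Nat.ofDigits (k + 1) (w.map (· + 1)) % n, Nat.mod_lt _ hn0⟩, ?_⟩
  intro w hw w' hw' h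
  have h := Fin.mk.inj h
  rw [Nat.mod_eq_of_lt (hlt w hw), Nat.mod_eq_of_lt (hlt w' hw')] at h
  rcases Nat.eq_zero_or_pos k with rfl | hk
  · rw [List.length_eq_zero_iff.1 (Nat.le_zero.1 hw.1),
      List.length_eq_zero_iff.1 (Nat.le_zero.1 hw'.1)]
  have hdig : ∀ w ∈ words k k,
      Nat.digits (k + 1) (Nat.ofDigits (k + 1) (w.map (· + 1))) = w.map (· + 1) := fun w hw => by
    refine Nat.digits_ofDigits _ (by omega) _ (fun x hx => ?_) fun hne => ?_
    · obtain ⟨a, ha, rfl⟩ := List.mem_map.1 hx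
      have := hw.2 a ha
      omega
    · obtain ⟨a, -, ha⟩ := List.mem_map.1 (List.getLast_mem hne)
      omega
  have := congrArg (Nat.digits (k + 1)) h
  rw [hdig w hw, hdig w' hw'] at this
  exact List.map_injective_iff.2 (fun a b hab => by simpa using hab) this

theorem le_binaryXOSGap {k : ℕ} (hk : 0 < k) (hn : (k + 1) ^ k ≤ n) :
    ENNReal.ofReal (k / 4) ≤ binaryXOSGap n := by
  obtain ⟨e, he⟩ := exists_injOn_words hn
  have hk' : (0 : ℝ) < k := Nat.cast_pos.2 hk
  set q : ℝ := 1 / k with hq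
  have q0 : 0 ≤ q := by positivity
  have q1 : q ≤ 1 := by
    rw [hq, div_le_one hk']; exact_mod_cast hk
  have hnil : ([] : List ℕ) ∈ words k k := ⟨by simp, by simp⟩
  set T : StrategyTree n := walk k e k [] with hT
  set I : Instance n := treeInstance (fun _ => q) (fun _ => q0) (fun _ => q1) T
    (nodup_walk _ hk he k [] hnil le_rfl) with hI
  set f : Finset (Fin n) → ℝ := fun S => (familyRank (downPaths k e k []) S : ℝ) with hf
  have hxos : IsBinaryXOS f := isBinaryXOS_familyRank (downPaths_nonempty hk e k [])
  have hadap : ENNReal.ofReal (k / 2) ≤ I.optAdap f := by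
    refine le_trans (ENNReal.ofReal_le_ofReal ?_)
      (le_iSup₂ (f := fun (T : StrategyTree n) (_ : I.IsAdaptiveStrategy T) =>
        ENNReal.ofReal (I.adap f T)) T fun x hx => ⟨x, hx, List.prefix_rfl⟩)
    refine le_trans ?_ (le_expect_walk q0 q1 hk he k [] hnil le_rfl)
    have h1 : (1 - q) ^ k ≤ 1 / 2 := by
      calc (1 - q) ^ k ≤ Real.exp (-q) ^ k :=
            pow_le_pow_left₀ (by linarith) (Real.one_sub_le_exp_neg q) k
        _ = (Real.exp 1)⁻¹ := by
          rw [← Real.exp_nat_mul, ← Real.exp_neg, hq]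
          congr 1
          field_simp
        _ ≤ 1 / 2 := by
          rw [one_div]
          exact inv_anti₀ two_pos (by linarith [Real.add_one_le_exp (1 : ℝ)])
    nlinarith
  have hnon : I.optNonadap f ≤ ENNReal.ofReal 2 := by
    refine iSup₂_le fun σ ⟨x, hx, hσ⟩ => ENNReal.ofReal_le_ofReal ?_
    obtain ⟨L, hL, hLR⟩ := exists_spine _ hk he k [] hnil le_rfl x hx
    calc I.nonadap f σ.toFinset
        ≤ probeExpect (fun _ => q) (fun S => 1 + (L.countP (fun y => y ∈ S) : ℝ)) σ.toFinset := by
          refine probeExpect_mono (fun _ => q0) (fun _ => q1) fun S hS => ?_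
          have hS' : S ⊆ x.path.toFinset := hS.trans fun y hy =>
            List.mem_toFinset.2 (hσ.subset (List.mem_toFinset.1 hy))
          have : familyRank (downPaths k e k []) S ≤ 1 + L.countP (fun y => y ∈ S) :=
            Finset.sup_le fun C hC => hLR S hS' C hC
          refine (Nat.cast_le (α := ℝ).2 this).trans_eq (by push_cast; rfl)
      _ ≤ 1 + L.length * q := probeExpect_one_add_countP_le (fun _ => q0) (fun _ => le_rfl) _ _
      _ ≤ 1 + k * q := by gcongr
      _ = 2 := by rw [hq, mul_one_div_cancel hk'.ne']; norm_num
  refine le_trans ?_ (le_iSup_of_le I (le_iSup₂_of_le f hxos le_rfl))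
  calc ENNReal.ofReal (k / 4) = ENNReal.ofReal (k / 2) / ENNReal.ofReal 2 := by
        rw [← ENNReal.ofReal_div_of_pos two_pos]; congr 1; ring
    _ ≤ I.adaptivityGap f := ENNReal.div_le_div hadap hnon

/-! ### Asymptotics -/

/-- Changing base only subtracts log log 2, which lies in [-1, 0], from the denominator log log x ≥
2. -/
theorem logb_ratio_bounds {x : ℝ} (h0 : 0 ≤ Real.log x) (hx : 2 ≤ Real.log (Real.log x)) :
    Real.logb 2 x / Real.logb 2 (Real.logb 2 x) ≤ Real.log x / Real.log (Real.log x) ∧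
      Real.log x / Real.log (Real.log x) ≤
        2 * (Real.logb 2 x / Real.logb 2 (Real.logb 2 x)) := by
  have hlog0 : Real.log x ≠ 0 := fun h => by rw [h, Real.log_zero] at hx; linarith
  have h2 : 0 < Real.log 2 := Real.log_pos one_lt_two
  have h2' : Real.log 2 < 1 := by linarith [Real.log_two_lt_d9]
  have h2'' : 1 / 2 < Real.log 2 := by linarith [Real.log_two_gt_d9]
  have hll : Real.log (Real.log 2) ≤ 0 := Real.log_nonpos h2.le h2'.le
  have hll' : -1 ≤ Real.log (Real.log 2) := by
    have := Real.one_sub_inv_le_log_of_pos h2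
    have h3 : (Real.log 2)⁻¹ ≤ 2 := by
      rw [inv_le_comm₀ h2 two_pos]; linarith
    linarith
  have e : Real.logb 2 x / Real.logb 2 (Real.logb 2 x) =
      Real.log x / (Real.log (Real.log x) - Real.log (Real.log 2)) := by
    unfold Real.logb
    rw [Real.log_div hlog0 h2.ne']
    field_simp
  rw [e, mul_div_assoc']
  constructor
  · exact div_le_div_of_nonneg_left h0 (by linarith) (by linarith)
  · rw [div_le_div_iff₀ (by linarith) (by linarith)]
    nlinarith

theorem eventually_two_le_log_log : ∀ᶠ n : ℕ in atTop, 2 ≤ Real.log (Real.log n) :=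
  ((Real.tendsto_log_atTop.comp Real.tendsto_log_atTop).comp
    tendsto_natCast_atTop_atTop).eventually_ge_atTop 2

theorem log_div_log_log_le_binaryXOSGap (hn : 2 ≤ Real.log (Real.log n)) :
    ENNReal.ofReal (1 / 8 * (Real.log n / Real.log (Real.log n))) ≤ binaryXOSGap n := by
  have hlog : 0 < Real.log n := by
    refine (Real.log_natCast_nonneg n).lt_of_ne' fun h => ?_
    rw [h, Real.log_zero] at hn
    linarith
  have hn0 : (0 : ℝ) < n := Nat.cast_pos.2 (Nat.pos_of_ne_zero fun h => by simp [h] at hlog)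
  have hll0 : 0 < Real.log (Real.log n) := by linarith
  set L := Real.log n with hL
  -- From log √L ≤ √L - 1 one gets 2 log L ≤ 4√L - 4 ≤ L.
  have hLL : 2 * Real.log L ≤ L := by
    have h1 : Real.log (Real.sqrt L) ≤ Real.sqrt L - 1 :=
      Real.log_le_sub_one_of_pos (Real.sqrt_pos.2 hlog)
    rw [Real.log_sqrt hlog.le] at h1
    nlinarith [Real.sq_sqrt hlog.le, sq_nonneg (Real.sqrt L - 2)]
  set r := L / Real.log L with hr
  have hr2 : 2 ≤ r := by rw [hr, le_div_iff₀ hll0]; exact hLL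
  have hrL : r * Real.log L = L := div_mul_cancel₀ _ hll0.ne'
  have hk1 : (⌊r⌋₊ : ℝ) ≤ r := Nat.floor_le (by linarith)
  have hk2 : r < ⌊r⌋₊ + 1 := Nat.lt_floor_add_one r
  have hk : 0 < ⌊r⌋₊ := Nat.floor_pos.2 (by linarith)
  refine le_trans (ENNReal.ofReal_le_ofReal ?_) (le_binaryXOSGap hk ?_)
  · linarith
  -- With k = ⌊r⌋ and k + 1 ≤ L, k log(k+1) ≤ r log L = log n, so the tree fits.
  · have h1 : ((⌊r⌋₊ : ℝ) + 1) ≤ L := by nlinarith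
    have h2 : Real.log ((⌊r⌋₊ : ℝ) + 1) ≤ Real.log L := Real.log_le_log (by positivity) h1
    have h3 : (((⌊r⌋₊ + 1) ^ ⌊r⌋₊ : ℕ) : ℝ) ≤ n := by
      rw [← Real.log_le_log_iff (by positivity) hn0]
      push_cast
      rw [Real.log_pow, ← hL, ← hrL]
      exact mul_le_mul hk1 h2 (Real.log_nonneg (by linarith)) (by linarith)
    exact_mod_cast h3

end StochasticProbing

theorem mainTheorem3 :
    ∃ c C : ℝ, 0 < c ∧ 0 < C ∧ ∀ᶠ n : ℕ in atTop,
      ENNReal.ofReal (c * (Real.logb 2 n / Real.logb 2 (Real.logb 2 n))) ≤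
          StochasticProbing.binaryXOSGap n ∧
        StochasticProbing.binaryXOSGap n ≤
          ENNReal.ofReal (C * (Real.logb 2 n / Real.logb 2 (Real.logb 2 n))) := by
  refine ⟨1 / 8, 12, by norm_num, by norm_num, ?_⟩
  filter_upwards [StochasticProbing.eventually_two_le_log_log] with n hn
  have hb := StochasticProbing.logb_ratio_bounds (Real.log_natCast_nonneg n) hn
  refine ⟨le_trans (ENNReal.ofReal_le_ofReal ?_)
    (StochasticProbing.log_div_log_log_le_binaryXOSGap hn), ?_⟩
  · linarith [hb.1]
  · refine iSup_le fun I => iSup₂_le fun f hf =>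
      (StochasticProbing.adaptivityGap_le (by linarith) I hf).trans
        (ENNReal.ofReal_le_ofReal ?_)
    linarith [hb.2]
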